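/- Call a differentiable function $f:\mathbb{R}^n\to\mathbb{R}$ $L$-smooth if $\|\nabla f(x)-\nabla f(y)\|\le L\|x-y\|$ for all $x,y\in\mathbb{R}^n$ (Euclidean norm). For $\gamma\in(0,1]$, call $f$ $\gamma$-quasar-convex with respect to a minimizer $x^*$ of $f$ if $f(x^*)\ge f(x)+\frac1\gamma\nabla f(x)^\top(x^*-x)$ for all $x\in\mathbb{R}^n$. A point $x$ is $\epsilon$-optimal for $f$ if $f(x)\le f(x^*)+\epsilon$ for a minimizer $x^*$ of $f$. A deterministic first-order method on $\mathbb{R}^n$ is a sequence of (arbitrary) maps $\mathcal{A}_k$, $k\ge 0$; run on $f$ from a starting point $x^{(0)}\in\mathbb{R}^n$ it produces the iterates $$x^{(k+1)}=\mathcal{A}_k\bigl(x^{(0)},\dots,x^{(k)},\,f(x^{(0)}),\dots,f(x^{(k)}),\,\nabla f(x^{(0)}),\dots,\nabla f(x^{(k)})\bigr),$$ so that $x^{(k)}$ is computed from $k$ gradient evaluations. **Theorem.** There is an absolute constant $c>0$ such that the following holds. Let $\epsilon,R,L\in(0,\infty)$ and $\gamma\in(0,1]$ with $L^{1/2}R\epsilon^{-1/2}\ge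 10^3$. Then there is $N\in\mathbb{N}$, depending only on $\epsilon,R,L,\gamma$, such that for every dimension $n\ge N$, every deterministic first-order method on $\mathbb{R}^n$ and every starting point $x^{(0)}\in\mathbb{R}^n$ there is an $L$-smooth function $f:\mathbb{R}^n\to\mathbb{R}$, $\gamma$-quasar-convex with respect to some point of Euclidean norm at most $R$, on which the method needs at least $c\,\gamma^{-1}L^{1/2}R\epsilon^{-1/2}$ gradient evaluations to find an $\epsilon$-optimal point: if the iterate $x^{(k)}$ is $\epsilon$-optimal for $f$, then $k\ge c\,\gamma^{-1}L^{1/2}R\epsilon^{-1/2}$. -/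

import Mathlib

/-- `f` is `L`-smooth: differentiable, with `L`-Lipschitz gradient for the Euclidean norm. -/
def LSmooth {n : ℕ} (L : ℝ) (f : EuclideanSpace ℝ (Fin n) → ℝ) : Prop :=
  Differentiable ℝ f ∧ ∀ x y, ‖gradient f x - gradient f y‖ ≤ L * ‖x - y‖

/-- `p` is a global minimizer of `f`. -/
def IsMinimizer {n : ℕ} (f : EuclideanSpace ℝ (Fin n) → ℝ) (p : EuclideanSpace ℝ (Fin n)) : Prop :=
  ∀ x, f p ≤ f x

/-- The differentiable function `f` is `γ`-quasar-convex with respect to its minimizer `p`. -/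
structure QuasarConvex {n : ℕ} (γ : ℝ) (f : EuclideanSpace ℝ (Fin n) → ℝ)
    (p : EuclideanSpace ℝ (Fin n)) : Prop where
  gamma_pos : 0 < γ
  gamma_le_one : γ ≤ 1
  differentiable : Differentiable ℝ f
  isMinimizer : IsMinimizer f p
  quasar : ∀ x, f x + 1 / γ * inner ℝ (gradient f x) (p - x) ≤ f p

/-- The `L`-smooth functions on `ℝⁿ` that are `γ`-quasar-convex with respect to some point of
Euclidean norm at most `R`. -/
def quasarClass (n : ℕ) (L R γ : ℝ) : Set (EuclideanSpace ℝ (Fin n) → ℝ) :=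
  {f | LSmooth L f ∧ ∃ p, ‖p‖ ≤ R ∧ QuasarConvex γ f p}

/-- `x` is `ε`-optimal for `f`: `f x ≤ f p + ε` for a minimizer `p` of `f`. -/
def EpsOptimal {n : ℕ} (ε : ℝ) (f : EuclideanSpace ℝ (Fin n) → ℝ)
    (x : EuclideanSpace ℝ (Fin n)) : Prop :=
  ∃ p, IsMinimizer f p ∧ f x ≤ f p + ε

/-- A deterministic first-order method on `ℝⁿ`: an arbitrary sequence of maps, the `k`-th of which
produces the iterate `x (k+1)` from the iterates `x 0, …, x k` and the values and gradients of the
objective at these points. -/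
structure FirstOrderMethod (n : ℕ) where
  next : (k : ℕ) → (points : Fin (k + 1) → EuclideanSpace ℝ (Fin n)) →
    (values : Fin (k + 1) → ℝ) → (gradients : Fin (k + 1) → EuclideanSpace ℝ (Fin n)) →
    EuclideanSpace ℝ (Fin n)

/-- The iterates of the method `A` run on `f` from the starting point `x₀`. The iterate with index
`k` is determined by the `k` gradient evaluations at the iterates with indices `0, …, k - 1`. -/
noncomputable def FirstOrderMethod.iterate {n : ℕ} (A : FirstOrderMethod n)
    (f : EuclideanSpace ℝ (Fin n) → ℝ) (x₀ : EuclideanSpace ℝ (Fin n)) :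
    ℕ → EuclideanSpace ℝ (Fin n)
  | 0 => x₀
  | k + 1 => A.next k (fun i => A.iterate f x₀ i) (fun i => f (A.iterate f x₀ i))
      (fun i => gradient f (A.iterate f x₀ i))
termination_by k => k
decreasing_by all_goals exact i.2

theorem FirstOrderMethod.iterate_zero {n : ℕ} (A : FirstOrderMethod n)
    (f : EuclideanSpace ℝ (Fin n) → ℝ) (x₀ : EuclideanSpace ℝ (Fin n)) :
    A.iterate f x₀ 0 = x₀ := by
  rw [FirstOrderMethod.iterate]

theorem FirstOrderMethod.iterate_succ {n : ℕ} (A : FirstOrderMethod n)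
    (f : EuclideanSpace ℝ (Fin n) → ℝ) (x₀ : EuclideanSpace ℝ (Fin n)) (k : ℕ) :
    A.iterate f x₀ (k + 1) =
      A.next k (fun i => A.iterate f x₀ i) (fun i => f (A.iterate f x₀ i))
        (fun i => gradient f (A.iterate f x₀ i)) := by
  rw [FirstOrderMethod.iterate]

/-!
The method is run against a function built to resist it. In suitable orthonormal coordinates
`y₀, …, y_{T-1}`, and up to scaling, this function is
`½ (1 - y₀)² + ½ ∑ (y_j - y_{j+1})² + σ ∑ well (y_j)`,
where `well` is a bounded well with minimum `well 1 = 0` whose slope vanishes at `0`. The all-ones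
point is the minimizer.

*Slow progress.* If `y_j = 0` for all `j ≥ k`, then value and gradient involve only the first
`k + 1` directions (`hardFun_eq_and_hardGrad_eq`). So the directions can be chosen one by one in
answer to the method, each orthogonal to everything queried so far, and the iterate with index `k`
is orthogonal to all directions from the `k`-th on (`exists_resisting_directions`); this needs only
dimension `3 T`. Every unreached coordinate costs `σ well 0 = σ / 6`
(`le_hardFun_of_inner_eq_zero`).

*Quasar-convexity.* Pairing the gradient with `x - x⋆` gives twice the quadratic part plus
`σ ∑ well' (y_j) (y_j - 1)`, whose terms are nonnegative and dominate `σ well (y_j)` once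
`y_j ≥ 1 / 4`. If some `y_j` is below `1 / 4`, then the chain, which starts at height `1`, has
crossed `[1 / 4, 3 / 4]`: few links make the quadratic part large, many links leave many
coordinates where the well is steep, and the balance is a lower bound `√σ / 16` whatever the length
(`chain_cost_of_lt`). Since all wells together are at most `σ T / 6`, the function is
`γ`-quasar-convex as long as `γ √σ T ≤ 3 / 8` (`chain_quasar`).

With `κ = √L R / √ε`, the scaling that makes the function `L`-smooth with minimizer of norm `R`
turns the depth of half of the wells into a constant times `L R² σ`, which exceeds `ε` for
`σ = (8 / κ)²`; then `T` may be as large as a constant times `κ / γ`.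
-/

/-! ### The one-dimensional well -/

/-- A bounded `C¹` well on the line: it is constant on `(-∞, 0]`, decreases from `1 / 6` to `0`
on `[0, 1]`, and vanishes on `[1, ∞)`. -/
noncomputable def well (t : ℝ) : ℝ :=
  (1 - max 0 (min t 1)) ^ 2 * (1 + 2 * max 0 (min t 1)) / 6

/-- The derivative of `well`, namely `-t (1 - t)` on `[0, 1]` and `0` elsewhere. -/
noncomputable def wellDeriv (t : ℝ) : ℝ :=
  -(max 0 (min t 1) * (1 - max 0 (min t 1)))

theorem well_zero : well 0 = 1 / 6 := by simp [well]

theorem well_one : well 1 = 0 := by simp [well]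

theorem wellDeriv_zero : wellDeriv 0 = 0 := by simp [wellDeriv]

theorem clamp_cases (t : ℝ) :
    (t ≤ 0 ∧ max 0 (min t 1) = 0) ∨ (0 ≤ t ∧ t ≤ 1 ∧ max 0 (min t 1) = t) ∨
      (1 ≤ t ∧ max 0 (min t 1) = 1) := by
  grind

theorem well_nonneg (t : ℝ) : 0 ≤ well t := by
  have h : 0 ≤ max 0 (min t 1) := le_max_left _ _
  unfold well
  positivity

theorem well_le (t : ℝ) : well t ≤ 1 / 6 := by
  unfold well
  rcases clamp_cases t with ⟨_, h⟩ | ⟨h0, h1, h⟩ | ⟨_, h⟩ <;> rw [h]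
  · norm_num
  · nlinarith [mul_nonneg (sq_nonneg t) (by linarith : 0 ≤ 3 - 2 * t)]
  · norm_num

theorem wellDeriv_mul_nonneg (t : ℝ) : 0 ≤ wellDeriv t * (t - 1) := by
  unfold wellDeriv
  rcases clamp_cases t with ⟨_, h⟩ | ⟨h0, h1, h⟩ | ⟨_, h⟩ <;> rw [h]
  · norm_num
  · nlinarith [mul_nonneg h0 (sq_nonneg (1 - t))]
  · norm_num

/-- To the right of `1 / 4` the well is star-convex about `1`. -/
theorem well_le_wellDeriv_mul {t : ℝ} (ht : 1 / 4 ≤ t) : well t ≤ wellDeriv t * (t - 1) := by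
  unfold well wellDeriv
  rcases clamp_cases t with ⟨_, h⟩ | ⟨h0, h1, h⟩ | ⟨_, h⟩ <;> rw [h]
  · linarith
  · nlinarith [mul_nonneg (by linarith : 0 ≤ 4 * t - 1) (sq_nonneg (1 - t))]
  · norm_num

theorem le_wellDeriv_mul {t : ℝ} (h0 : 1 / 4 ≤ t) (h1 : t ≤ 3 / 4) :
    3 / 64 ≤ wellDeriv t * (t - 1) := by
  unfold wellDeriv
  rcases clamp_cases t with ⟨_, h⟩ | ⟨_, _, h⟩ | ⟨_, h⟩ <;> try linarith
  rw [h]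
  have h2 : 1 / 16 ≤ (1 - t) ^ 2 := by nlinarith
  nlinarith [mul_nonneg (by linarith : 0 ≤ t - 1 / 4) (by linarith : 0 ≤ 3 / 4 - t)]

theorem abs_wellDeriv_sub_le (x y : ℝ) : |wellDeriv x - wellDeriv y| ≤ |x - y| := by
  have hc : |max 0 (min x 1) - max 0 (min y 1)| ≤ |x - y| := by
    rcases clamp_cases x with ⟨_, h⟩ | ⟨_, _, h⟩ | ⟨_, h⟩ <;>
    rcases clamp_cases y with ⟨_, h'⟩ | ⟨_, _, h'⟩ | ⟨_, h'⟩ <;> rw [h, h'] <;>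
    rw [abs_le] <;> constructor <;> cases abs_cases (x - y) <;> linarith
  have hx : 0 ≤ max 0 (min x 1) ∧ max 0 (min x 1) ≤ 1 := by grind
  have hy : 0 ≤ max 0 (min y 1) ∧ max 0 (min y 1) ≤ 1 := by grind
  unfold wellDeriv
  generalize max 0 (min x 1) = a at *
  generalize max 0 (min y 1) = b at *
  calc |-(a * (1 - a)) - -(b * (1 - b))| = |a - b| * |a + b - 1| := by
        rw [← abs_mul]; congr 1; ring
    _ ≤ |a - b| * 1 := by
        gcongr
        rw [abs_le]; constructor <;> linarith
    _ ≤ |x - y| := by linarith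

theorem abs_well_sub_le (x y : ℝ) :
    |well y - well x - (y - x) * wellDeriv x| ≤ 2 * (y - x) ^ 2 := by
  unfold well wellDeriv
  rcases clamp_cases x with ⟨hx, h⟩ | ⟨hx, hx', h⟩ | ⟨hx, h⟩ <;>
  rcases clamp_cases y with ⟨hy, h'⟩ | ⟨hy, hy', h'⟩ | ⟨hy, h'⟩ <;> rw [h, h']
  · simp; positivity
  · have h1 : y ^ 2 ≤ (y - x) ^ 2 := by nlinarith
    have h2 : 0 ≤ y ^ 2 * y := by positivity
    have h3 : 0 ≤ y ^ 2 * (1 - y) := mul_nonneg (sq_nonneg y) (by linarith)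
    rw [abs_le]; constructor <;> nlinarith
  · rw [abs_le]; constructor <;> nlinarith
  · have h1 : 0 ≤ (x - y) * -y := mul_nonneg (by linarith) (by linarith)
    have h2 : 0 ≤ (x - y) * x * x := mul_nonneg (mul_nonneg (by linarith) hx) hx
    have h3 : 0 ≤ (x - y) * x * (1 - x) :=
      mul_nonneg (mul_nonneg (by linarith) hx) (by linarith)
    have h4 : 0 ≤ x ^ 2 * x := by positivity
    have h5 : 0 ≤ x ^ 2 * (1 - x) := mul_nonneg (sq_nonneg x) (by linarith)
    have h6 : x ^ 2 ≤ (y - x) ^ 2 := by nlinarith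
    rw [abs_le]; constructor <;> nlinarith
  · rw [abs_le]
    constructor <;>
    nlinarith [mul_nonneg hx (sq_nonneg (y - x)), mul_nonneg hy (sq_nonneg (y - x)),
      mul_nonneg (sub_nonneg.2 hx') (sq_nonneg (y - x)),
      mul_nonneg (sub_nonneg.2 hy') (sq_nonneg (y - x))]
  · have h1 : 0 ≤ (y - x) * (y - 1) := mul_nonneg (by linarith) (by linarith)
    have h2 : 0 ≤ (y - x) * x * (1 - x) :=
      mul_nonneg (mul_nonneg (by linarith) hx) (by linarith)
    have h3 : 0 ≤ (y - x) * (1 - x) * (1 - x) :=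
      mul_nonneg (mul_nonneg (by linarith) (by linarith)) (by linarith)
    have h4 : 0 ≤ (1 - x) ^ 2 * x := by positivity
    have h5 : 0 ≤ (1 - x) ^ 2 * (1 - x) := mul_nonneg (sq_nonneg _) (by linarith)
    have h6 : (1 - x) ^ 2 ≤ (y - x) ^ 2 := by nlinarith
    rw [abs_le]; constructor <;> nlinarith
  · rw [abs_le]; constructor <;> nlinarith
  · have h1 : (1 - y) ^ 2 ≤ (y - x) ^ 2 := by nlinarith
    have h2 : 0 ≤ (1 - y) ^ 2 * y := by positivity
    have h3 : 0 ≤ (1 - y) ^ 2 * (1 - y) := mul_nonneg (sq_nonneg _) (by linarith)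
    rw [abs_le]; constructor <;> nlinarith
  · simp; positivity

theorem hasDerivAt_well (x : ℝ) : HasDerivAt well (wellDeriv x) x := by
  rw [hasDerivAt_iff_isLittleO]
  refine Asymptotics.IsBigO.trans_isLittleO (g := fun y => (y - x) ^ 2)
    (Asymptotics.IsBigO.of_bound 2 (Filter.Eventually.of_forall fun y => ?_)) ?_
  · simpa [Real.norm_eq_abs, smul_eq_mul] using abs_well_sub_le x y
  · simpa using Asymptotics.isLittleO_pow_sub_sub x one_lt_two

/-! ### The chain inequality -/

/-- A chain which starts at height `1` and has stayed above `1 / 4` pays at least a constant times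
its loss of height, since the squared step and the slope of the well balance. -/
theorem chain_cost_of_ge {σ : ℝ} (hσ : 0 ≤ σ) (e : ℕ → ℝ) (he : e 0 = 1) (m : ℕ)
    (h : ∀ j < m, 1 / 4 ≤ e (j + 1)) :
    √σ / 4 * (3 / 4 - e m) ≤ 1 / 2 * ∑ j ∈ Finset.range m, (e (j + 1) - e j) ^ 2 +
      σ * ∑ j ∈ Finset.range m, wellDeriv (e (j + 1)) * (e (j + 1) - 1) := by
  have hs := Real.sqrt_nonneg σ
  have hs2 := Real.sq_sqrt hσ
  induction m with
  | zero => simp [he]; nlinarith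
  | succ m ih =>
    have hm := ih fun j hj => h j (hj.trans m.lt_succ_self)
    by_cases hb : 3 / 4 ≤ e (m + 1)
    · have h1 : 0 ≤ ∑ j ∈ Finset.range (m + 1), (e (j + 1) - e j) ^ 2 :=
        Finset.sum_nonneg fun j _ => sq_nonneg _
      have h2 : 0 ≤ σ * ∑ j ∈ Finset.range (m + 1), wellDeriv (e (j + 1)) * (e (j + 1) - 1) :=
        mul_nonneg hσ (Finset.sum_nonneg fun j _ => wellDeriv_mul_nonneg _)
      nlinarith
    · have hg := mul_le_mul_of_nonneg_left
        (le_wellDeriv_mul (h m m.lt_succ_self) (not_le.1 hb).le) hσ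
      rw [Finset.sum_range_succ, Finset.sum_range_succ, mul_add, mul_add]
      nlinarith [sq_nonneg (4 * (e (m + 1) - e m) + √σ)]

/-- A chain which starts at height `1` and drops below `1 / 4` pays at least `√σ / 16`, however
long it is. -/
theorem chain_cost_of_lt {σ : ℝ} (hσ : 0 ≤ σ) (hσ1 : σ ≤ 1) (e : ℕ → ℝ) (he : e 0 = 1) {T : ℕ}
    (h : ∃ j < T, e (j + 1) < 1 / 4) :
    √σ / 16 ≤ 1 / 2 * ∑ j ∈ Finset.range T, (e (j + 1) - e j) ^ 2 +
      σ * ∑ j ∈ Finset.range T, wellDeriv (e (j + 1)) * (e (j + 1) - 1) := by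
  classical
  have hs := Real.sqrt_nonneg σ
  have hs1 : √σ ≤ 1 := Real.sqrt_le_one.2 hσ1
  -- the first index at which the chain is below `1 / 4`
  obtain ⟨hiT, hi⟩ := Nat.find_spec h
  have hmin : ∀ j < Nat.find h, 1 / 4 ≤ e (j + 1) := fun j hj => by
    by_contra hlt
    exact Nat.find_min h hj ⟨hj.trans hiT, not_le.1 hlt⟩
  generalize Nat.find h = i at *
  have hcost := chain_cost_of_ge hσ e he i hmin
  have hei : 1 / 4 ≤ e i := by
    cases i with
    | zero => rw [he]; norm_num
    | succ i => exact hmin i i.lt_succ_self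
  have hsub : Finset.range (i + 1) ⊆ Finset.range T := Finset.range_subset_range.2 hiT
  have h1 := Finset.sum_le_sum_of_subset_of_nonneg hsub
    fun j _ _ => sq_nonneg (e (j + 1) - e j)
  have h2 := mul_le_mul_of_nonneg_left (Finset.sum_le_sum_of_subset_of_nonneg hsub
    fun j _ _ => wellDeriv_mul_nonneg (e (j + 1))) hσ
  rw [Finset.sum_range_succ] at h1
  rw [Finset.sum_range_succ, mul_add] at h2
  have h3 := mul_nonneg hσ (wellDeriv_mul_nonneg (e (i + 1)))
  have h4 : (e i - 1 / 4) ^ 2 ≤ (e (i + 1) - e i) ^ 2 := by nlinarith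
  nlinarith [sq_nonneg (e i - 1 / 4 - √σ / 4)]

/-- The quasar-convexity inequality in the coordinates of the chain. -/
theorem chain_quasar {σ γ : ℝ} (hσ : 0 ≤ σ) (hσ1 : σ ≤ 1) (hγ : 0 < γ) (hγ1 : γ ≤ 1)
    (e : ℕ → ℝ) (he : e 0 = 1) {T : ℕ} (hT : γ * √σ * T ≤ 3 / 8) :
    γ * (1 / 2 * ∑ j ∈ Finset.range T, (e (j + 1) - e j) ^ 2 +
        σ * ∑ j ∈ Finset.range T, well (e (j + 1))) ≤
      ∑ j ∈ Finset.range T, (e (j + 1) - e j) ^ 2 +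
        σ * ∑ j ∈ Finset.range T, wellDeriv (e (j + 1)) * (e (j + 1) - 1) := by
  have hq : 0 ≤ ∑ j ∈ Finset.range T, (e (j + 1) - e j) ^ 2 :=
    Finset.sum_nonneg fun j _ => sq_nonneg _
  have hw : 0 ≤ ∑ j ∈ Finset.range T, well (e (j + 1)) := Finset.sum_nonneg fun j _ => well_nonneg _
  by_cases h : ∃ j < T, e (j + 1) < 1 / 4
  · have hcost := chain_cost_of_lt hσ hσ1 e he h
    have hle : ∑ j ∈ Finset.range T, well (e (j + 1)) ≤ T * (1 / 6) := by
      simpa using Finset.sum_le_card_nsmul (Finset.range T) _ _ fun j _ => well_le (e (j + 1))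
    have hs := Real.sqrt_nonneg σ
    have hs2 := Real.mul_self_sqrt hσ
    have h1 : γ * (σ * ∑ j ∈ Finset.range T, well (e (j + 1))) ≤ γ * (σ * (T * (1 / 6))) := by
      gcongr
    have h2 : γ * (σ * (T * (1 / 6))) ≤ √σ / 16 := by
      calc γ * (σ * (T * (1 / 6))) = √σ / 6 * (γ * √σ * T) := by
            linear_combination (-(γ * T / 6)) * hs2
        _ ≤ √σ / 6 * (3 / 8) := by gcongr
        _ = √σ / 16 := by ring
    nlinarith
  · push Not at h
    have hle : ∑ j ∈ Finset.range T, well (e (j + 1)) ≤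
        ∑ j ∈ Finset.range T, wellDeriv (e (j + 1)) * (e (j + 1) - 1) :=
      Finset.sum_le_sum fun j hj => well_le_wellDeriv_mul (h j (Finset.mem_range.1 hj))
    have h1 := mul_le_mul_of_nonneg_left hle hσ
    have h2 := mul_nonneg hσ hw
    nlinarith

/-! ### The hard function -/

section HardFunction

variable {E : Type*} [NormedAddCommGroup E] [InnerProductSpace ℝ E]

/-- The heights of the chain at `x`, in the scaled coordinates along `u`; a fixed link of
height `1` is put in front, so that the coordinate along `u j` has index `j + 1`. -/
def chainHeight (s : ℝ) (u : ℕ → E) (x : E) : ℕ → ℝ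
  | 0 => 1
  | j + 1 => s * inner ℝ (u j) x

/-- The direction in which the `j`-th link of the chain varies. -/
def linkDir (u : ℕ → E) : ℕ → E
  | 0 => u 0
  | j + 1 => u (j + 1) - u j

/-- The hard function: a quadratic chain with links `1, y₀, …, y_{T-1}`, where
`y_j = s ⟪u_j, x⟫`, and a well of weight `σ` on every `y_j`, all multiplied by `A`. -/
noncomputable def hardFun (A s σ : ℝ) (T : ℕ) (u : ℕ → E) (x : E) : ℝ :=
  A * (1 / 2 * ∑ j ∈ Finset.range T,
      (chainHeight s u x (j + 1) - chainHeight s u x j) ^ 2 +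
    σ * ∑ j ∈ Finset.range T, well (chainHeight s u x (j + 1)))

/-- The gradient of `hardFun`. -/
noncomputable def hardGrad (A s σ : ℝ) (T : ℕ) (u : ℕ → E) (x : E) : E :=
  (A * s) • (∑ j ∈ Finset.range T,
      (chainHeight s u x (j + 1) - chainHeight s u x j) • linkDir u j +
    σ • ∑ j ∈ Finset.range T, wellDeriv (chainHeight s u x (j + 1)) • u j)

/-- The vectors `u 0, …, u (T - 1)` are orthonormal. -/
def OrthonormalUpTo (T : ℕ) (u : ℕ → E) : Prop :=
  ∀ i < T, ∀ j < T, inner ℝ (u i) (u j) = if i = j then (1 : ℝ) else 0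

theorem chainHeight_link_sub (s : ℝ) (u : ℕ → E) (x y : E) (j : ℕ) :
    (chainHeight s u x (j + 1) - chainHeight s u x j) -
      (chainHeight s u y (j + 1) - chainHeight s u y j) = s * inner ℝ (linkDir u j) (x - y) := by
  cases j <;> simp only [chainHeight, linkDir, inner_sub_left, inner_sub_right] <;> ring

theorem hasFDerivAt_chainHeight_succ (s : ℝ) (u : ℕ → E) (x : E) (j : ℕ) :
    HasFDerivAt (fun x => chainHeight s u x (j + 1)) (s • innerSL ℝ (u j)) x :=
  ((innerSL ℝ (u j)).hasFDerivAt).const_mul s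

theorem hasFDerivAt_chainHeight_link (s : ℝ) (u : ℕ → E) (x : E) (j : ℕ) :
    HasFDerivAt (fun x => chainHeight s u x (j + 1) - chainHeight s u x j)
      (s • innerSL ℝ (linkDir u j)) x := by
  cases j with
  | zero => exact (hasFDerivAt_chainHeight_succ s u x 0).sub_const 1
  | succ j =>
    convert! (hasFDerivAt_chainHeight_succ s u x (j + 1)).sub
      (hasFDerivAt_chainHeight_succ s u x j) using 1
    simp [linkDir, smul_sub]

theorem hasGradientAt_hardFun [CompleteSpace E] (A s σ : ℝ) (T : ℕ) (u : ℕ → E) (x : E) :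
    HasGradientAt (hardFun A s σ T u) (hardGrad A s σ T u x) x := by
  rw [hasGradientAt_iff_hasFDerivAt]
  have h1 := HasFDerivAt.fun_sum (u := Finset.range T) fun j _ =>
    (hasFDerivAt_chainHeight_link s u x j).pow 2
  have h2 := HasFDerivAt.fun_sum (u := Finset.range T) fun j _ =>
    (hasDerivAt_well _).comp_hasFDerivAt x (hasFDerivAt_chainHeight_succ s u x j)
  convert! ((h1.const_mul (1 / 2)).add (h2.const_mul σ)).const_mul A using 1
  ext z
  simp [hardGrad, Finset.mul_sum]
  congr 1 <;> refine Finset.sum_congr rfl fun j _ => by ring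

theorem inner_hardGrad_sub (A s σ : ℝ) (T : ℕ) (u : ℕ → E) (x y z : E) :
    inner ℝ (hardGrad A s σ T u x - hardGrad A s σ T u y) z =
      (A * s) * (∑ j ∈ Finset.range T, s * inner ℝ (linkDir u j) (x - y) * inner ℝ (linkDir u j) z +
        σ * ∑ j ∈ Finset.range T, (wellDeriv (chainHeight s u x (j + 1)) -
          wellDeriv (chainHeight s u y (j + 1))) * inner ℝ (u j) z) := by
  simp only [← chainHeight_link_sub, hardGrad, inner_sub_left, inner_add_left, sum_inner,
    inner_smul_left, conj_trivial, sub_mul, Finset.sum_sub_distrib]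
  ring

theorem OrthonormalUpTo.sum_inner_sq_le {T : ℕ} {u : ℕ → E} (hu : OrthonormalUpTo T u) (z : E) :
    ∑ j ∈ Finset.range T, inner ℝ (u j) z ^ 2 ≤ ‖z‖ ^ 2 := by
  have ho : Orthonormal ℝ fun j : Fin T => u j := by
    rw [orthonormal_iff_ite]
    intro i j
    rw [hu i i.2 j j.2]
    simp [Fin.ext_iff]
  have h := ho.sum_inner_products_le z (s := Finset.univ)
  rw [Finset.sum_range]
  simpa using h

theorem OrthonormalUpTo.sum_inner_linkDir_sq_le {T : ℕ} {u : ℕ → E} (hu : OrthonormalUpTo T u)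
    (z : E) : ∑ j ∈ Finset.range T, inner ℝ (linkDir u j) z ^ 2 ≤ 4 * ‖z‖ ^ 2 := by
  have key : ∀ m, ∑ j ∈ Finset.range (m + 1), inner ℝ (linkDir u j) z ^ 2 +
      2 * inner ℝ (u m) z ^ 2 ≤ 4 * ∑ j ∈ Finset.range (m + 1), inner ℝ (u j) z ^ 2 := by
    intro m
    induction m with
    | zero => simp [linkDir]; nlinarith [sq_nonneg (inner ℝ (u 0) z)]
    | succ m ih =>
      rw [Finset.sum_range_succ, Finset.sum_range_succ _ (m + 1)]
      simp only [linkDir, inner_sub_left] at ih ⊢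
      nlinarith [sq_nonneg (inner ℝ (u (m + 1)) z + inner ℝ (u m) z)]
  cases T with
  | zero => simp
  | succ m => nlinarith [key m, hu.sum_inner_sq_le z, sq_nonneg (inner ℝ (u m) z)]

/-- The Cauchy–Schwarz inequality for coefficients dominated by those of `x` along a family `v`
whose frame bound is `K`. -/
theorem sum_mul_inner_le_of_frame_bound {ι : Type*} (t : Finset ι) (v : ι → E) {K : ℝ} (hK : 0 ≤ K)
    (hv : ∀ z, ∑ j ∈ t, inner ℝ (v j) z ^ 2 ≤ K * ‖z‖ ^ 2) (a : ι → ℝ) (x z : E)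
    (ha : ∀ j ∈ t, |a j| ≤ |inner ℝ (v j) x|) :
    ∑ j ∈ t, a j * inner ℝ (v j) z ≤ K * ‖x‖ * ‖z‖ := by
  have ha2 : ∑ j ∈ t, a j ^ 2 ≤ K * ‖x‖ ^ 2 :=
    (Finset.sum_le_sum fun j hj => sq_le_sq.2 (ha j hj)).trans (hv x)
  refine le_of_sq_le_sq ?_ (by positivity)
  calc (∑ j ∈ t, a j * inner ℝ (v j) z) ^ 2
      ≤ (∑ j ∈ t, a j ^ 2) * ∑ j ∈ t, inner ℝ (v j) z ^ 2 :=
        Finset.sum_mul_sq_le_sq_mul_sq _ _ _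
    _ ≤ (K * ‖x‖ ^ 2) * (K * ‖z‖ ^ 2) :=
        mul_le_mul ha2 (hv z) (Finset.sum_nonneg fun j _ => sq_nonneg _) (by positivity)
    _ = (K * ‖x‖ * ‖z‖) ^ 2 := by ring

theorem OrthonormalUpTo.norm_hardGrad_sub_le {T : ℕ} {u : ℕ → E} (hu : OrthonormalUpTo T u)
    {A s σ : ℝ} (hA : 0 ≤ A) (hs : 0 ≤ s) (hσ : 0 ≤ σ) (x y : E) :
    ‖hardGrad A s σ T u x - hardGrad A s σ T u y‖ ≤ A * s ^ 2 * (4 + σ) * ‖x - y‖ := by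
  set z := hardGrad A s σ T u x - hardGrad A s σ T u y with hz
  have h1 : ∑ j ∈ Finset.range T, s * inner ℝ (linkDir u j) (x - y) * inner ℝ (linkDir u j) z ≤
      4 * ‖s • (x - y)‖ * ‖z‖ :=
    sum_mul_inner_le_of_frame_bound _ _ (by norm_num) hu.sum_inner_linkDir_sq_le _ _ _
      fun j _ => by rw [inner_smul_right]
  have h2 : ∑ j ∈ Finset.range T, (wellDeriv (chainHeight s u x (j + 1)) -
      wellDeriv (chainHeight s u y (j + 1))) * inner ℝ (u j) z ≤ 1 * ‖s • (x - y)‖ * ‖z‖ :=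
    sum_mul_inner_le_of_frame_bound _ _ (by norm_num)
      (fun w => by simpa using hu.sum_inner_sq_le w) _ _ _ fun j _ => by
        refine (abs_wellDeriv_sub_le _ _).trans_eq ?_
        simp only [chainHeight, inner_smul_right, inner_sub_right, mul_sub]
  have h3 : ‖z‖ ^ 2 ≤ A * s ^ 2 * (4 + σ) * ‖x - y‖ * ‖z‖ := by
    rw [← real_inner_self_eq_norm_sq]
    nth_rw 1 [hz]
    rw [inner_hardGrad_sub]
    rw [norm_smul, Real.norm_of_nonneg hs] at h1 h2
    calc _ ≤ (A * s) * (4 * (s * ‖x - y‖) * ‖z‖ + σ * (1 * (s * ‖x - y‖) * ‖z‖)) := by gcongr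
      _ = _ := by ring
  rcases (norm_nonneg z).eq_or_lt with h0 | h0
  · rw [← h0]; positivity
  · rw [sq] at h3; exact le_of_mul_le_mul_right h3 h0

/-- The minimizer of the hard function, at which every link of the chain has height `1`. -/
noncomputable def hardMin (s : ℝ) (T : ℕ) (u : ℕ → E) : E :=
  s⁻¹ • ∑ j ∈ Finset.range T, u j

theorem OrthonormalUpTo.chainHeight_hardMin {T : ℕ} {u : ℕ → E} (hu : OrthonormalUpTo T u)
    {s : ℝ} (hs : s ≠ 0) {j : ℕ} (hj : j ≤ T) : chainHeight s u (hardMin s T u) j = 1 := by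
  cases j with
  | zero => rfl
  | succ j =>
    have h : ∑ i ∈ Finset.range T, inner ℝ (u j) (u i) = (1 : ℝ) := by
      rw [Finset.sum_congr rfl fun i hi => hu j hj i (Finset.mem_range.1 hi)]
      simp [Nat.lt_of_succ_le hj]
    simp [chainHeight, hardMin, inner_smul_right, inner_sum, h, hs]

theorem OrthonormalUpTo.norm_hardMin {T : ℕ} {u : ℕ → E} (hu : OrthonormalUpTo T u)
    {s : ℝ} (hs : 0 ≤ s) : ‖hardMin s T u‖ = s⁻¹ * √T := by
  have h : ‖∑ j ∈ Finset.range T, u j‖ ^ 2 = T := by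
    rw [← real_inner_self_eq_norm_sq, sum_inner]
    simp_rw [inner_sum]
    rw [Finset.sum_congr rfl fun i hi => Finset.sum_congr rfl fun j hj =>
      hu i (Finset.mem_range.1 hi) j (Finset.mem_range.1 hj)]
    simp +contextual
  rw [hardMin, norm_smul, Real.norm_of_nonneg (inv_nonneg.2 hs), ← h, Real.sqrt_sq (norm_nonneg _)]

theorem OrthonormalUpTo.hardFun_hardMin {T : ℕ} {u : ℕ → E} (hu : OrthonormalUpTo T u)
    {A s σ : ℝ} (hs : s ≠ 0) : hardFun A s σ T u (hardMin s T u) = 0 := by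
  have h1 : ∀ j ∈ Finset.range T, chainHeight s u (hardMin s T u) (j + 1) = 1 := fun j hj =>
    hu.chainHeight_hardMin hs (Finset.mem_range.1 hj)
  have h0 : ∀ j ∈ Finset.range T, chainHeight s u (hardMin s T u) j = 1 := fun j hj =>
    hu.chainHeight_hardMin hs (Finset.mem_range.1 hj).le
  rw [hardFun, Finset.sum_eq_zero fun j hj => by rw [h1 j hj, h0 j hj]; norm_num,
    Finset.sum_eq_zero fun j hj => by rw [h1 j hj, well_one]]
  simp

theorem hardFun_nonneg {A s σ : ℝ} (hA : 0 ≤ A) (hσ : 0 ≤ σ) (T : ℕ) (u : ℕ → E) (x : E) :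
    0 ≤ hardFun A s σ T u x :=
  mul_nonneg hA (add_nonneg
    (mul_nonneg (by norm_num) (Finset.sum_nonneg fun j _ => sq_nonneg _))
    (mul_nonneg hσ (Finset.sum_nonneg fun j _ => well_nonneg _)))

theorem OrthonormalUpTo.inner_hardGrad {T : ℕ} {u : ℕ → E} (hu : OrthonormalUpTo T u)
    {A s σ : ℝ} (hs : s ≠ 0) (x : E) :
    inner ℝ (hardGrad A s σ T u x) (x - hardMin s T u) =
      A * (∑ j ∈ Finset.range T, (chainHeight s u x (j + 1) - chainHeight s u x j) ^ 2 +
        σ * ∑ j ∈ Finset.range T,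
          wellDeriv (chainHeight s u x (j + 1)) * (chainHeight s u x (j + 1) - 1)) := by
  have h1 : ∀ j ∈ Finset.range T, s * inner ℝ (linkDir u j) (x - hardMin s T u) =
      chainHeight s u x (j + 1) - chainHeight s u x j := fun j hj => by
    have hj' := Finset.mem_range.1 hj
    rw [← chainHeight_link_sub, hu.chainHeight_hardMin hs hj', hu.chainHeight_hardMin hs hj'.le]
    ring
  have h2 : ∀ j ∈ Finset.range T, s * inner ℝ (u j) (x - hardMin s T u) =
      chainHeight s u x (j + 1) - 1 := fun j hj => by
    rw [← hu.chainHeight_hardMin hs (Finset.mem_range.1 hj)]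
    simp only [chainHeight, inner_sub_right, mul_sub]
  have h3 : ∑ j ∈ Finset.range T, (chainHeight s u x (j + 1) - chainHeight s u x j) ^ 2 =
      ∑ j ∈ Finset.range T, (chainHeight s u x (j + 1) - chainHeight s u x j) *
        (s * inner ℝ (linkDir u j) (x - hardMin s T u)) :=
    Finset.sum_congr rfl fun j hj => by rw [h1 j hj, sq]
  rw [h3, ← Finset.sum_congr rfl fun j hj => congrArg (wellDeriv _ * ·) (h2 j hj)]
  simp only [hardGrad, inner_add_left, sum_inner, inner_smul_left, conj_trivial,
    mul_left_comm _ s, ← Finset.mul_sum]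
  ring

end HardFunction

theorem OrthonormalUpTo.quasarConvex_hardFun {n T : ℕ} {u : ℕ → EuclideanSpace ℝ (Fin n)}
    (hu : OrthonormalUpTo T u) {A s σ γ : ℝ} (hA : 0 ≤ A) (hs : s ≠ 0) (hσ : 0 ≤ σ) (hσ1 : σ ≤ 1)
    (hγ : 0 < γ) (hγ1 : γ ≤ 1) (hT : γ * √σ * T ≤ 3 / 8) :
    QuasarConvex γ (hardFun A s σ T u) (hardMin s T u) where
  gamma_pos := hγ
  gamma_le_one := hγ1
  differentiable x := (hasGradientAt_hardFun A s σ T u x).differentiableAt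
  isMinimizer x := by rw [hu.hardFun_hardMin hs]; exact hardFun_nonneg hA hσ T u x
  quasar x := by
    rw [hu.hardFun_hardMin hs, (hasGradientAt_hardFun A s σ T u x).gradient, ← neg_sub x,
      inner_neg_right, hu.inner_hardGrad hs]
    have h := mul_le_mul_of_nonneg_left
      (chain_quasar hσ hσ1 hγ hγ1 (chainHeight s u x) rfl hT) hA
    have h' : γ * hardFun A s σ T u x ≤ A * (∑ j ∈ Finset.range T,
        (chainHeight s u x (j + 1) - chainHeight s u x j) ^ 2 + σ * ∑ j ∈ Finset.range T,
          wellDeriv (chainHeight s u x (j + 1)) * (chainHeight s u x (j + 1) - 1)) :=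
      (le_of_eq (by rw [hardFun]; ring)).trans h
    rw [mul_neg, ← sub_eq_add_neg, sub_nonpos, one_div, inv_mul_eq_div, le_div_iff₀' hγ]
    exact h'

theorem OrthonormalUpTo.lSmooth_hardFun {n T : ℕ} {u : ℕ → EuclideanSpace ℝ (Fin n)}
    (hu : OrthonormalUpTo T u) {A s σ : ℝ} (hA : 0 ≤ A) (hs : 0 ≤ s) (hσ : 0 ≤ σ) :
    LSmooth (A * s ^ 2 * (4 + σ)) (hardFun A s σ T u) := by
  refine ⟨fun x => (hasGradientAt_hardFun A s σ T u x).differentiableAt, fun x y => ?_⟩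
  rw [(hasGradientAt_hardFun A s σ T u x).gradient, (hasGradientAt_hardFun A s σ T u y).gradient]
  exact hu.norm_hardGrad_sub_le hA hs hσ x y

/-! ### The resisting oracle -/

/-- In dimension at least `m + T` there are `T` orthonormal vectors orthogonal to `m` given ones. -/
theorem exists_orthonormalUpTo_orthogonal {n T : ℕ} (S : Finset (EuclideanSpace ℝ (Fin n)))
    (h : S.card + T ≤ n) :
    ∃ w : ℕ → EuclideanSpace ℝ (Fin n), OrthonormalUpTo T w ∧
      ∀ j < T, ∀ z ∈ S, inner ℝ (w j) z = 0 := by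
  set K := Submodule.span ℝ (S : Set (EuclideanSpace ℝ (Fin n)))
  have h1 : Module.finrank ℝ K ≤ S.card := finrank_span_finset_le_card S
  have h2 := K.finrank_add_finrank_orthogonal
  rw [finrank_euclideanSpace_fin] at h2
  have h3 : T ≤ Module.finrank ℝ Kᗮ := by omega
  set b := stdOrthonormalBasis ℝ Kᗮ
  refine ⟨fun j => if hj : j < T then (b ⟨j, hj.trans_le h3⟩ : EuclideanSpace ℝ (Fin n)) else 0,
    fun i hi j hj => ?_, fun j hj z hz => ?_⟩
  · have := orthonormal_iff_ite.1 b.orthonormal ⟨i, hi.trans_le h3⟩ ⟨j, hj.trans_le h3⟩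
    simpa [hi, hj] using this
  · simp only [dif_pos hj]
    exact Submodule.inner_left_of_mem_orthogonal (Submodule.subset_span hz) (Subtype.prop _)

section Locality

variable {E : Type*} [NormedAddCommGroup E] [InnerProductSpace ℝ E]

/-- The first-order information of the hard function at a point orthogonal to all directions from
`u k` on reveals `u 0, …, u k` only. -/
theorem hardFun_eq_and_hardGrad_eq (A s σ : ℝ) (T : ℕ) {u w : ℕ → E} {k : ℕ} {x : E}
    (huw : ∀ j ≤ k, u j = w j) (hu : ∀ j < T, k ≤ j → inner ℝ (u j) x = 0)
    (hw : ∀ j < T, k ≤ j → inner ℝ (w j) x = 0) :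
    hardFun A s σ T u x = hardFun A s σ T w x ∧ hardGrad A s σ T u x = hardGrad A s σ T w x := by
  have hc : ∀ j ≤ T, chainHeight s u x j = chainHeight s w x j := by
    intro j hj
    cases j with
    | zero => rfl
    | succ j =>
      simp only [chainHeight]
      by_cases hjk : j ≤ k
      · rw [huw j hjk]
      · rw [hu j hj (not_le.1 hjk).le, hw j hj (not_le.1 hjk).le]
  have hd : ∀ j ≤ k, linkDir u j = linkDir w j := by
    intro j hj
    cases j with
    | zero => exact huw 0 hj
    | succ j => simp only [linkDir, huw _ hj, huw j (Nat.le_of_succ_le hj)]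
  have hlink : ∀ j < T, k < j → chainHeight s w x (j + 1) - chainHeight s w x j = 0 := by
    intro j hj hkj
    cases j with
    | zero => omega
    | succ j => simp [chainHeight, hw (j + 1) hj hkj.le, hw j (by omega) (by omega)]
  constructor
  · unfold hardFun
    congr 2
    · congr 1
      refine Finset.sum_congr rfl fun j hj => ?_
      have hj := Finset.mem_range.1 hj
      rw [hc j hj.le, hc (j + 1) hj]
    · congr 1
      refine Finset.sum_congr rfl fun j hj => ?_
      rw [hc (j + 1) (Finset.mem_range.1 hj)]
  · unfold hardGrad
    congr 2
    · refine Finset.sum_congr rfl fun j hj => ?_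
      have hj := Finset.mem_range.1 hj
      rw [hc j hj.le, hc (j + 1) hj]
      by_cases hjk : j ≤ k
      · rw [hd j hjk]
      · rw [hlink j hj (not_le.1 hjk), zero_smul, zero_smul]
    · congr 1
      refine Finset.sum_congr rfl fun j hj => ?_
      have hj := Finset.mem_range.1 hj
      rw [hc (j + 1) hj]
      by_cases hjk : j ≤ k
      · rw [huw j hjk]
      · have h0 : chainHeight s w x (j + 1) = 0 := by
          simp [chainHeight, hw j hj (not_le.1 hjk).le]
        rw [h0, wellDeriv_zero, zero_smul, zero_smul]

end Locality

/-- Two objectives with the same first-order information at the first `m` iterates have the same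
iterates up to index `m`. -/
theorem FirstOrderMethod.iterate_eq_of_agree {n : ℕ} (M : FirstOrderMethod n)
    {f g : EuclideanSpace ℝ (Fin n) → ℝ} (x₀ : EuclideanSpace ℝ (Fin n)) {m : ℕ}
    (h : ∀ k < m, M.iterate f x₀ k = M.iterate g x₀ k →
      f (M.iterate f x₀ k) = g (M.iterate f x₀ k) ∧
        gradient f (M.iterate f x₀ k) = gradient g (M.iterate f x₀ k)) :
    ∀ k ≤ m, M.iterate f x₀ k = M.iterate g x₀ k := by
  intro k
  induction k using Nat.strong_induction_on with
  | _ k ih =>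
    intro hk
    cases k with
    | zero => rw [M.iterate_zero, M.iterate_zero]
    | succ k =>
      have hi : ∀ i : Fin (k + 1), M.iterate f x₀ i = M.iterate g x₀ i := fun i =>
        ih i i.2 (by omega)
      have hfg := fun i : Fin (k + 1) => h i (by omega) (hi i)
      rw [M.iterate_succ, M.iterate_succ]
      simp only [← hi, fun i => (hfg i).1, fun i => (hfg i).2]

/-- The directions can be chosen, in answer to a given method, so that every iterate with index
`k` is orthogonal to all the directions from `u k` on. -/
theorem exists_resisting_directions {n T : ℕ} (hn : 3 * T ≤ n) (M : FirstOrderMethod n)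
    (x₀ : EuclideanSpace ℝ (Fin n)) (A s σ : ℝ) :
    ∃ u : ℕ → EuclideanSpace ℝ (Fin n), OrthonormalUpTo T u ∧
      ∀ k < T, ∀ j < T, k ≤ j → inner ℝ (u j) (M.iterate (hardFun A s σ T u) x₀ k) = 0 := by
  suffices H : ∀ m ≤ T, ∃ u : ℕ → EuclideanSpace ℝ (Fin n), OrthonormalUpTo T u ∧
      ∀ k < m, ∀ j < T, k ≤ j → inner ℝ (u j) (M.iterate (hardFun A s σ T u) x₀ k) = 0 from
    H T le_rfl
  intro m
  induction m with
  | zero =>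
    intro _
    obtain ⟨u, hu, -⟩ := exists_orthonormalUpTo_orthogonal (n := n) (T := T) ∅ (by simp; omega)
    exact ⟨u, hu, fun k hk => absurd hk k.not_lt_zero⟩
  | succ m ih =>
    intro hm
    classical
    obtain ⟨u, hu, hux⟩ := ih (by omega)
    set x := M.iterate (hardFun A s σ T u) x₀ with hx
    -- replace the directions from `u m` on, of which the method has learnt nothing so far
    set S := (Finset.range m).image u ∪ (Finset.range (m + 1)).image x with hS
    have hcard : S.card ≤ m + (m + 1) := by
      refine (Finset.card_union_le _ _).trans (add_le_add ?_ ?_) <;>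
      simpa using Finset.card_image_le (s := Finset.range _)
    obtain ⟨w, hw, hwS⟩ := exists_orthonormalUpTo_orthogonal (T := T) S (by omega)
    have hwu : ∀ j < T, ∀ i < m, inner ℝ (w j) (u i) = 0 := fun j hj i hi =>
      hwS j hj _ (Finset.mem_union_left _ (Finset.mem_image_of_mem _ (Finset.mem_range.2 hi)))
    have hwx : ∀ j < T, ∀ i ≤ m, inner ℝ (w j) (x i) = 0 := fun j hj i hi =>
      hwS j hj _ (Finset.mem_union_right _
        (Finset.mem_image_of_mem _ (Finset.mem_range.2 (Nat.lt_succ_of_le hi))))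
    set v : ℕ → EuclideanSpace ℝ (Fin n) := fun j => if j < m then u j else w j with hv
    have hvo : OrthonormalUpTo T v := by
      intro i hi j hj
      by_cases him : i < m <;> by_cases hjm : j < m
      · simpa [hv, him, hjm] using hu i hi j hj
      · have hij : i ≠ j := by omega
        simpa [hv, him, hjm, hij, real_inner_comm] using hwu j hj i him
      · have hij : i ≠ j := by omega
        simpa [hv, him, hjm, hij] using hwu i hi j hjm
      · simpa [hv, him, hjm] using hw i hi j hj
    have hvx : ∀ k ≤ m, ∀ j < T, k ≤ j → inner ℝ (v j) (x k) = 0 := by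
      intro k hk j hj hkj
      by_cases hjm : j < m
      · simpa [hv, hjm] using hux k (by omega) j hj hkj
      · simpa [hv, hjm] using hwx j hj k hk
    have hiter : ∀ k ≤ m, x k = M.iterate (hardFun A s σ T v) x₀ k := by
      refine M.iterate_eq_of_agree x₀ fun k hk _ => ?_
      rw [(hasGradientAt_hardFun A s σ T u _).gradient,
        (hasGradientAt_hardFun A s σ T v _).gradient]
      exact hardFun_eq_and_hardGrad_eq A s σ T (fun j hj => by simp [hv, hj.trans_lt hk])
        (hux k hk) (hvx k hk.le)
    refine ⟨v, hvo, fun k hk j hj hkj => ?_⟩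
    rw [← hiter k (Nat.le_of_lt_succ hk)]
    exact hvx k (Nat.le_of_lt_succ hk) j hj hkj

/-! ### The lower bound -/

/-- Every coordinate which has not been reached yet contributes the depth of a well. -/
theorem le_hardFun_of_inner_eq_zero {E : Type*} [NormedAddCommGroup E] [InnerProductSpace ℝ E]
    {A s σ : ℝ} (hA : 0 ≤ A) (hσ : 0 ≤ σ) {T k : ℕ} {u : ℕ → E} {x : E} (hk : k ≤ T)
    (hx : ∀ j < T, k ≤ j → inner ℝ (u j) x = 0) :
    A * (σ * ((T - k) / 6)) ≤ hardFun A s σ T u x := by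
  unfold hardFun
  have h : ((T : ℝ) - k) / 6 ≤ ∑ j ∈ Finset.range T, well (chainHeight s u x (j + 1)) := by
    calc ((T : ℝ) - k) / 6 = ∑ j ∈ Finset.Ico k T, well (chainHeight s u x (j + 1)) := by
          rw [Finset.sum_congr rfl fun j hj => by
            rw [chainHeight, hx j (Finset.mem_Ico.1 hj).2 (Finset.mem_Ico.1 hj).1, mul_zero,
              well_zero]]
          rw [Finset.sum_const, Nat.card_Ico, nsmul_eq_mul, Nat.cast_sub hk]
          ring
      _ ≤ _ := Finset.sum_le_sum_of_subset_of_nonneg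
          (fun j hj => Finset.mem_range.2 (Finset.mem_Ico.1 hj).2) fun j _ _ => well_nonneg _
  have hq : 0 ≤ 1 / 2 * ∑ j ∈ Finset.range T,
      (chainHeight s u x (j + 1) - chainHeight s u x j) ^ 2 :=
    mul_nonneg (by norm_num) (Finset.sum_nonneg fun j _ => sq_nonneg _)
  gcongr
  nlinarith [mul_le_mul_of_nonneg_left h hσ]

theorem LSmooth.mono {n : ℕ} {L L' : ℝ} {f : EuclideanSpace ℝ (Fin n) → ℝ} (hf : LSmooth L f)
    (h : L ≤ L') : LSmooth L' f :=
  ⟨hf.1, fun x y => (hf.2 x y).trans (by gcongr)⟩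

theorem mainTheorem3 :
    ∃ c : ℝ, 0 < c ∧
      ∀ ε R L γ : ℝ, 0 < ε → 0 < R → 0 < L → 0 < γ → γ ≤ 1 →
        10 ^ 3 ≤ √L * R / √ε →
        ∃ N : ℕ, ∀ n : ℕ, N ≤ n →
          ∀ (A : FirstOrderMethod n) (x₀ : EuclideanSpace ℝ (Fin n)),
            ∃ f ∈ quasarClass n L R γ,
              ∀ k : ℕ, EpsOptimal ε f (A.iterate f x₀ k) →
                c * (γ⁻¹ * (√L * R / √ε)) ≤ (k : ℝ) := by
  refine ⟨1 / 64, by norm_num, fun ε R L γ hε hR hL hγ hγ1 hκ => ?_⟩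
  have hκ2 : (√L * R / √ε) ^ 2 * ε = L * R ^ 2 := by
    rw [div_pow, mul_pow, Real.sq_sqrt hL.le, Real.sq_sqrt hε.le]
    field_simp
  set κ := √L * R / √ε with hκdef
  have hκ0 : 0 < κ := by linarith
  -- `σ` makes the depth of half of the wells exceed `ε`, after scaling
  set σ : ℝ := (8 / κ) ^ 2 with hσdef
  have hσ : 0 ≤ σ := sq_nonneg _
  have hsσ : √σ = 8 / κ := Real.sqrt_sq (by positivity)
  have h8 : 8 / κ ≤ 1 := by rw [div_le_one hκ0]; linarith
  have hσ1 : σ ≤ 1 := pow_le_one₀ (by positivity) h8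
  -- the longest chain for which the hard function is `γ`-quasar-convex
  set T : ℕ := ⌊3 / 64 * (γ⁻¹ * κ)⌋₊ with hTdef
  have hγκ : κ ≤ γ⁻¹ * κ := le_mul_of_one_le_left hκ0.le ((one_le_inv₀ hγ).2 hγ1)
  have hTle : (T : ℝ) ≤ 3 / 64 * (γ⁻¹ * κ) := Nat.floor_le (by positivity)
  have hTlt : 3 / 64 * (γ⁻¹ * κ) < T + 1 := Nat.lt_floor_add_one _
  have hT0 : (0 : ℝ) < T := by linarith
  have hTγ : γ * √σ * T ≤ 3 / 8 := by
    calc γ * √σ * T ≤ γ * √σ * (3 / 64 * (γ⁻¹ * κ)) := by gcongr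
      _ = 3 / 8 := by rw [hsσ]; field_simp; norm_num
  -- the scaling which gives the smoothness `L` and puts the minimizer at distance `R`
  set s : ℝ := √T / R with hsdef
  set B : ℝ := L * R ^ 2 / (5 * T) with hBdef
  have hs : 0 < s := by positivity
  have hB : 0 ≤ B := by positivity
  have hBs : B * s ^ 2 = L / 5 := by
    rw [hsdef, div_pow, Real.sq_sqrt hT0.le, hBdef]
    field_simp
  refine ⟨3 * T, fun n hn M x₀ => ?_⟩
  obtain ⟨u, hu, hux⟩ := exists_resisting_directions hn M x₀ B s σ
  refine ⟨hardFun B s σ T u, ⟨(hu.lSmooth_hardFun hB hs.le hσ).mono ?_, hardMin s T u, ?_,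
    hu.quasarConvex_hardFun hB hs.ne' hσ hσ1 hγ hγ1 hTγ⟩, ?_⟩
  · rw [hBs]; nlinarith
  · rw [hu.norm_hardMin hs.le, hsdef]
    exact le_of_eq (by field_simp)
  · rintro k ⟨p, hp, hk⟩
    have hp0 := (hp (hardMin s T u)).trans_eq (hu.hardFun_hardMin hs.ne')
    by_contra hlt
    have hkT : (k : ℝ) ≤ T / 2 := by linarith
    have hkT' : k < T := by exact_mod_cast (by linarith : (k : ℝ) < T)
    have hle := le_hardFun_of_inner_eq_zero (s := s) hB hσ hkT'.le (hux k hkT')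
    have hgap : B * (σ * ((T - T / 2) / 6)) = 16 / 15 * ε := by
      rw [hBdef, ← hκ2, hσdef]
      field_simp
      norm_num
    have hmono : B * (σ * ((T - T / 2) / 6)) ≤ B * (σ * ((T - k) / 6)) := by gcongr
    linarith
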